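/- Let $u\in C^2(\mathbb R)$ be real-valued with $\int_{\mathbb R}(1+|x|)\,|u(x)|\,dx<\infty$. For $k\in\mathbb R$ consider the Schrödinger equation $$v''(x)+\bigl(u(x)+k^2\bigr)v(x)=0,\qquad x\in\mathbb R, \tag{$*$}$$ for $C^2$ functions $v:\mathbb R\to\mathbb C$. For every $k\in\mathbb R$ there are unique solutions $\varphi_k,\psi_k,\overline\psi_k$ of $(*)$ with $$\varphi_k(x)\sim e^{-ikx}\ (x\to-\infty),\qquad \psi_k(x)\sim e^{ikx}\ (x\to+\infty),\qquad \overline\psi_k(x)\sim e^{-ikx}\ (x\to+\infty),$$ and for every real $k\neq0$ there are unique $A(k),B(k)\in\mathbb C$ with $\varphi_k=A(k)\psi_k+B(k)\overline\psi_k$. (Likewise the solution $\sim e^{ikx}$ at $-\infty$ exists and is unique.) Put $$M_k(x)=\varphi_k(x)e^{ikx},\qquad \overline N_k(x)=\overline\psi_k(x)e^{ikx}.$$ Then: 1. For every $x\in\mathbb R$ the function $k\mapsto M_k(x)$, $k\in\mathbb R$, extends to a continuous function on $\{\operatorname{Im}k\ge0\}$ that is analytic in $\{\operatorname{Im}k>0\}$,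 and the function $k\mapsto B(k)$, $k\in\mathbb R\setminus\{0\}$, extends to a continuous function on $\{\operatorname{Im}k\ge0\}\setminus\{0\}$ that is analytic in $\{\operatorname{Im}k>0\}$. The extensions satisfy $$\lim_{|k|\to\infty,\ \operatorname{Im}k\ge0}M_k(x)=1\quad(x\in\mathbb R),\qquad \lim_{|k|\to\infty,\ \operatorname{Im}k\ge0}B(k)=1.$$ 2. For every $x\in\mathbb R$ the function $k\mapsto\overline N_k(x)$, $k\in\mathbb R$, extends to a continuous function on $\{\operatorname{Im}k\le0\}$ that is analytic in $\{\operatorname{Im}k<0\}$, and $$\lim_{|k|\to\infty,\ \operatorname{Im}k\le0}\overline N_k(x)=1.$$ -/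

import Mathlib

open Filter Topology Asymptotics MeasureTheory

noncomputable section

/-- The Faddeev class `P₁`: real `C²` potentials with `∫ (1 + |x|) |u x| dx < ∞`. -/
def IsFaddeevPotential (u : ℝ → ℝ) : Prop :=
  ContDiff ℝ 2 u ∧ Integrable (fun x : ℝ => (1 + |x|) * |u x|)

/-- `v` is a `C²` solution of the Schrödinger equation `v'' + u v = -k² v` on the real line. -/
def IsSchrodingerSolution (u : ℝ → ℝ) (k : ℝ) (v : ℝ → ℂ) : Prop :=
  ContDiff ℝ 2 v ∧ ∀ x : ℝ, iteratedDeriv 2 v x + (u x : ℂ) * v x = -(k : ℂ) ^ 2 * v x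

/-- `v` solves the equation with spectral parameter `k²` and `v x ∼ exp (i k x)` along the
filter `l`, which is `atBot` or `atTop`, that is `x → -∞` or `x → +∞`. -/
def IsJostSolution (u : ℝ → ℝ) (l : Filter ℝ) (k : ℝ) (v : ℝ → ℂ) : Prop :=
  IsSchrodingerSolution u k v ∧
    IsEquivalent l v (fun x : ℝ => Complex.exp (Complex.I * (k : ℂ) * (x : ℂ)))

/-- The solution of the equation with behaviour `exp (i k x)` along `l`. Its existence and
uniqueness for potentials in the Faddeev class are part of the theorem. -/
def jostSolution (u : ℝ → ℝ) (l : Filter ℝ) (k : ℝ) : ℝ → ℂ :=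
  Classical.epsilon (IsJostSolution u l k)

/-- `φ_k x ∼ exp (-i k x)` as `x → -∞`. -/
def jostPhi (u : ℝ → ℝ) (k : ℝ) : ℝ → ℂ := jostSolution u atBot (-k)

/-- `ψ_k x ∼ exp (i k x)` as `x → +∞`. -/
def jostPsi (u : ℝ → ℝ) (k : ℝ) : ℝ → ℂ := jostSolution u atTop k

/-- `ψ̄_k x ∼ exp (-i k x)` as `x → +∞`. -/
def jostPsiBar (u : ℝ → ℝ) (k : ℝ) : ℝ → ℂ := jostSolution u atTop (-k)

/-- The pair `(A, B)` satisfies `φ_k = A ψ_k + B ψ̄_k`. -/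
def IsScatteringPair (u : ℝ → ℝ) (k : ℝ) (p : ℂ × ℂ) : Prop :=
  ∀ x : ℝ, jostPhi u k x = p.1 * jostPsi u k x + p.2 * jostPsiBar u k x

/-- The coefficient `B(k)` in `φ_k = A(k) ψ_k + B(k) ψ̄_k`, for real `k ≠ 0`. Existence and
uniqueness of the pair of coefficients are part of the theorem. -/
def scatteringB (u : ℝ → ℝ) (k : ℝ) : ℂ :=
  (Classical.epsilon (IsScatteringPair u k)).2

/-- `M_k x = φ_k x * exp (i k x)`. -/
def normalizedM (u : ℝ → ℝ) (k x : ℝ) : ℂ :=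
  jostPhi u k x * Complex.exp (Complex.I * (k : ℂ) * (x : ℂ))

/-- `N̄_k x = ψ̄_k x * exp (i k x)`. -/
def normalizedNBar (u : ℝ → ℝ) (k x : ℝ) : ℂ :=
  jostPsiBar u k x * Complex.exp (Complex.I * (k : ℂ) * (x : ℂ))

/-- `F` extends the function `f`, given on the real points of `D`, to the subset `D` of the
complex plane: `F` is continuous on `D`, equal to `f` at the real points of `D`, and analytic
on the interior of `D`. -/
def IsAnalyticExtension (D : Set ℂ) (f : ℝ → ℂ) (F : ℂ → ℂ) : Prop :=
  (∀ k : ℝ, (k : ℂ) ∈ D → F k = f k) ∧ ContinuousOn F D ∧ AnalyticOnNhd ℂ F (interior D)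

/-- `F k → c` as `|k| → ∞` with `k ∈ D`. -/
def TendstoAtInfinityIn (D : Set ℂ) (F : ℂ → ℂ) (c : ℂ) : Prop :=
  Tendsto F (Bornology.cobounded ℂ ⊓ 𝓟 D) (𝓝 c)

end

noncomputable section

/-! Write a solution that behaves like `exp (i k x)` at `+∞` as `exp (i k x) m(k, x)`. Then `m'' + 2
i k m' + u m = 0` and `m → 1`, which becomes the Volterra equation `m(x) = 1 - ∫_x^∞ K_k(y - x) u(y)
m(y) dy` with `K_k(t) = (exp (2 i k t) - 1) / (2 i k)`. For `Im k ≥ 0` and `t ≥ 0` the kernel is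
bounded both by `t` and by `1/|k|`. The first bound and the moment condition on `u` make the Neumann
series converge geometrically, uniformly in `k` and in `x ≥ a` (`norm_neumannTerm_le`), so `m`
inherits continuity and analyticity in `k` from the kernel. The second bound gives `m - 1 =
O(1/|k|)` (`norm_faddeevM_sub_one_le_div`). Projecting `k` to the closed half-plane inside the
kernel makes the estimates and the continuity valid on all of `ℂ`.

For real `k` the function `exp (i k x) m` is a Jost solution. It is the only one, because a solution
that tends to zero at `+∞` vanishes (`eq_zero_of_tendsto_zero`). The reflection `x ↦ -x` gives the
Jost solutions at `-∞`. Thus, with `m̃` belonging to `u(-x)`, `M_k(x) = m̃(k, -x)` and `N̄_k(x) =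
m(-k, x)`. Finally `B(k)` is the Wronskian of `φ_k` and `ψ_k` divided by `2 i k`; at `x = 0` it
involves only `m`, `m̃` and their derivatives, all of which continue to `Im k ≥ 0`. -/

/-! ### Parameter integrals and tail integrals -/

/-- No bound on the `k`-derivative is needed: Cauchy's estimate on circles of radius `r / 4` around
points of `ball k₀ (r / 2)` derives one from `b`. -/
theorem differentiableOn_integral_of_dominated {μ : Measure ℝ} {U : Set ℂ} (hU : IsOpen U)
    {f : ℂ → ℝ → ℂ} (hc : Continuous (Function.uncurry f))
    (hd : ∀ y, DifferentiableOn ℂ (fun k => f k y) U) {b : ℝ → ℝ} (hb : Integrable b μ)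
    (hle : ∀ᵐ y ∂μ, ∀ k ∈ U, ‖f k y‖ ≤ b y) :
    DifferentiableOn ℂ (fun k => ∫ y, f k y ∂μ) U := by
  intro k₀ hk₀
  obtain ⟨r, hr, hrU⟩ := Metric.isOpen_iff.1 hU k₀ hk₀
  have hmeas : ∀ k, AEStronglyMeasurable (f k) μ := fun k =>
    (hc.comp (Continuous.prodMk_right k)).aestronglyMeasurable
  have hsub : ∀ k ∈ Metric.ball k₀ (r / 2), Metric.closedBall k (r / 4) ⊆ U := by
    intro k hk z hz
    apply hrU
    rw [Metric.mem_ball] at hk ⊢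
    rw [Metric.mem_closedBall] at hz
    linarith [dist_triangle z k k₀]
  refine ((hasDerivAt_integral_of_dominated_loc_of_deriv_le (F := f)
    (F' := fun k y => deriv (fun z => f z y) k) (bound := fun y => b y / (r / 4))
    (Metric.ball_mem_nhds k₀ (half_pos hr)) (Eventually.of_forall hmeas) ?_ ?_ ?_
    (hb.div_const _) ?_).2).differentiableAt.differentiableWithinAt
  · exact hb.mono' (hmeas k₀) (hle.mono fun y hy => hy k₀ hk₀)
  · have hc' : Continuous (Function.uncurry fun (y : ℝ) (k : ℂ) => f k y) :=
      hc.comp continuous_swap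
    exact ((measurable_deriv_with_param hc').comp
      (measurable_id.prodMk measurable_const)).aestronglyMeasurable
  · filter_upwards [hle] with y hy k hk
    have h4 : 0 < r / 4 := by linarith
    refine Complex.norm_deriv_le_of_forall_mem_sphere_norm_le h4 ?_ ?_
    · apply DifferentiableOn.diffContOnCl
      refine (hd y).mono ((closure_mono Metric.ball_subset_closedBall).trans ?_)
      rw [Metric.isClosed_closedBall.closure_eq]
      exact hsub k hk
    · intro z hz
      exact hy z (hsub k hk (Metric.sphere_subset_closedBall hz))
  · refine Eventually.of_forall fun y k hk => ?_
    have hkU : k ∈ U := hsub k hk (Metric.mem_closedBall_self (by linarith))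
    exact ((hd y).differentiableAt (hU.mem_nhds hkU)).hasDerivAt

theorem hasDerivAt_integral_Ioi {E : Type*} [NormedAddCommGroup E] [NormedSpace ℝ E]
    [CompleteSpace E] {f : ℝ → E} (hc : Continuous f)
    (hi : ∀ a, IntegrableOn f (Set.Ioi a)) (x : ℝ) :
    HasDerivAt (fun x => ∫ y in Set.Ioi x, f y) (-f x) x := by
  have h : (fun x => ∫ y in Set.Ioi x, f y) =
      fun x => (∫ y in Set.Ioi 0, f y) - ∫ y in (0 : ℝ)..x, f y := by
    funext z
    rw [← intervalIntegral.integral_Ioi_sub_Ioi' (hi 0) (hi z)]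
    abel
  rw [h]
  exact (intervalIntegral.integral_hasDerivAt_right (hc.intervalIntegrable _ _)
    (hc.stronglyMeasurableAtFilter _ _) hc.continuousAt).const_sub _

theorem tendsto_integral_Ioi_atTop {E : Type*} [NormedAddCommGroup E] [NormedSpace ℝ E]
    [CompleteSpace E] {f : ℝ → E} {a : ℝ} (hi : IntegrableOn f (Set.Ioi a)) :
    Tendsto (fun x => ∫ y in Set.Ioi x, f y) atTop (𝓝 0) := by
  have h := intervalIntegral_tendsto_integral_Ioi a hi tendsto_id
  have h2 := (tendsto_const_nhds (x := ∫ y in Set.Ioi a, f y)).sub h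
  rw [sub_self] at h2
  refine h2.congr' ?_
  filter_upwards [eventually_ge_atTop a] with x hx
  rw [id, ← intervalIntegral.integral_Ioi_sub_Ioi hi hx]
  abel

/-! ### The Volterra kernel -/

/-- The projection onto the closed upper half-plane. -/
def upperProj (k : ℂ) : ℂ := ⟨k.re, max k.im 0⟩

theorem upperProj_of_im_nonneg {k : ℂ} (hk : 0 ≤ k.im) : upperProj k = k :=
  Complex.ext rfl (max_eq_left hk)

theorem upperProj_im_nonneg (k : ℂ) : 0 ≤ (upperProj k).im := le_max_right _ _

theorem continuous_upperProj : Continuous upperProj := by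
  have : upperProj = fun k : ℂ => (k.re : ℂ) + ((max k.im 0 : ℝ) : ℂ) * Complex.I := by
    funext k
    exact Complex.mk_eq_add_mul_I _ _
  rw [this]
  fun_prop

theorem isOpen_im_pos : IsOpen {k : ℂ | 0 < k.im} :=
  isOpen_lt continuous_const Complex.continuous_im

theorem differentiableOn_upperProj : DifferentiableOn ℂ upperProj {k : ℂ | 0 < k.im} :=
  differentiableOn_id.congr fun _ hk => upperProj_of_im_nonneg (le_of_lt hk)

/-- This is `(exp z - 1) / z` with its removable singularity filled in, so that the kernel needs no
separate case `k = 0`. -/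
theorem differentiable_dslope_exp : Differentiable ℂ (dslope Complex.exp 0) := by
  rw [← differentiableOn_univ, Complex.differentiableOn_dslope univ_mem]
  exact Complex.differentiable_exp.differentiableOn

/-- Mean value inequality on the convex half-plane `re ≤ 0`, where `exp` has derivative of norm at
most one. -/
theorem norm_exp_sub_one_le_of_re_nonpos {z : ℂ} (hz : z.re ≤ 0) :
    ‖Complex.exp z - 1‖ ≤ ‖z‖ := by
  have h := (convex_halfSpace_re_le 0).norm_image_sub_le_of_norm_deriv_le (𝕜 := ℂ)
    (f := Complex.exp) (C := 1) (x := 0) (y := z)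
    (fun w _ => Complex.differentiable_exp w) (fun w hw => ?_) (by simp) hz
  · simpa using h
  · rw [Complex.deriv_exp, Complex.norm_exp]
    exact Real.exp_le_one_iff.2 hw

theorem norm_dslope_exp_le_one {z : ℂ} (hz : z.re ≤ 0) : ‖dslope Complex.exp 0 z‖ ≤ 1 := by
  rcases eq_or_ne z 0 with rfl | h0
  · simp [dslope_same]
  · rw [dslope_of_ne _ h0, slope_def_field, norm_div, Complex.exp_zero, sub_zero]
    exact div_le_one_of_le₀ (norm_exp_sub_one_le_of_re_nonpos hz) (norm_nonneg _)

theorem norm_mul_dslope_exp_le_two {z : ℂ} (hz : z.re ≤ 0) :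
    ‖z * dslope Complex.exp 0 z‖ ≤ 2 := by
  have h : z * dslope Complex.exp 0 z = Complex.exp z - 1 := by
    simpa using sub_smul_dslope Complex.exp 0 z
  rw [h]
  refine (norm_sub_le _ _).trans ?_
  rw [Complex.norm_exp, norm_one]
  linarith [Real.exp_le_one_iff.2 hz]

/-- The kernel `(exp (2 i k t) - 1) / (2 i k)` for `t ≥ 0`, equal to zero for `t ≤ 0`, with the
parameter projected onto the closed upper half-plane. -/
def volterraKernel (k : ℂ) (t : ℝ) : ℂ :=
  ((max t 0 : ℝ) : ℂ) *
    dslope Complex.exp 0 (2 * Complex.I * upperProj k * ((max t 0 : ℝ) : ℂ))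

theorem re_two_I_mul_nonpos (k : ℂ) {t : ℝ} (ht : 0 ≤ t) :
    (2 * Complex.I * upperProj k * (t : ℂ)).re ≤ 0 := by
  have h : (2 * Complex.I * upperProj k * (t : ℂ)).re = -(2 * (upperProj k).im * t) := by
    simp
  rw [h]
  have := mul_nonneg (upperProj_im_nonneg k) ht
  linarith

theorem continuous_volterraKernel :
    Continuous (fun p : ℂ × ℝ => volterraKernel p.1 p.2) := by
  have h1 := differentiable_dslope_exp.continuous
  have h2 := continuous_upperProj
  unfold volterraKernel
  fun_prop

theorem differentiableOn_volterraKernel (t : ℝ) :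
    DifferentiableOn ℂ (fun k => volterraKernel k t) {k : ℂ | 0 < k.im} := by
  refine DifferentiableOn.const_mul ?_ _
  refine differentiable_dslope_exp.comp_differentiableOn ?_
  exact (differentiableOn_upperProj.const_mul _).mul_const _

theorem norm_volterraKernel_le (k : ℂ) (t : ℝ) : ‖volterraKernel k t‖ ≤ max t 0 := by
  rw [volterraKernel, norm_mul, Complex.norm_real, Real.norm_of_nonneg (le_max_right _ _)]
  exact mul_le_of_le_one_right (le_max_right _ _)
    (norm_dslope_exp_le_one (re_two_I_mul_nonpos k (le_max_right _ _)))

theorem volterraKernel_of_nonpos (k : ℂ) {t : ℝ} (ht : t ≤ 0) : volterraKernel k t = 0 := by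
  simp [volterraKernel, max_eq_right ht]

theorem two_I_mul_volterraKernel {k : ℂ} (hk : 0 ≤ k.im) {t : ℝ} (ht : 0 ≤ t) :
    2 * Complex.I * k * volterraKernel k t = Complex.exp (2 * Complex.I * k * t) - 1 := by
  have h := sub_smul_dslope Complex.exp 0 (2 * Complex.I * k * t)
  rw [volterraKernel, max_eq_left ht, upperProj_of_im_nonneg hk]
  simp only [sub_zero, smul_eq_mul, Complex.exp_zero] at h
  rw [← h]
  ring

theorem volterraKernel_zero {t : ℝ} (ht : 0 ≤ t) : volterraKernel 0 t = t := by
  have : upperProj 0 = 0 := upperProj_of_im_nonneg le_rfl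
  simp [volterraKernel, this, dslope_same, max_eq_left ht]

theorem norm_volterraKernel_le_inv {k : ℂ} (hk : 0 ≤ k.im) (h0 : k ≠ 0) (t : ℝ) :
    ‖volterraKernel k t‖ ≤ ‖k‖⁻¹ := by
  rcases le_total t 0 with ht | ht
  · rw [volterraKernel_of_nonpos k ht, norm_zero]
    positivity
  · have hk0 : 0 < ‖k‖ := norm_pos_iff.2 h0
    have hre := re_two_I_mul_nonpos k ht
    rw [upperProj_of_im_nonneg hk] at hre
    have h := norm_mul_dslope_exp_le_two hre
    have h2 : 2 * Complex.I * k * t * dslope Complex.exp 0 (2 * Complex.I * k * t) =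
        2 * Complex.I * k * volterraKernel k t := by
      rw [volterraKernel, max_eq_left ht, upperProj_of_im_nonneg hk]
      ring
    rw [h2] at h
    simp only [norm_mul, Complex.norm_ofNat, Complex.norm_I, mul_one] at h
    rw [← one_div, le_div_iff₀ hk0]
    linarith

/-! ### The weight and the majorant -/

/-- The tail `∫_x^∞ (1 + |y|) |u y| dy`. -/
def weightTail (u : ℝ → ℝ) (x : ℝ) : ℝ := ∫ y in Set.Ioi x, (1 + |y|) * |u y|

theorem weightTail_nonneg (u : ℝ → ℝ) (x : ℝ) : 0 ≤ weightTail u x :=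
  integral_nonneg fun _ => by positivity

theorem continuous_weight {u : ℝ → ℝ} (hc : Continuous u) :
    Continuous fun x : ℝ => (1 + |x|) * |u x| := by
  fun_prop

theorem hasDerivAt_weightTail {u : ℝ → ℝ} (hc : Continuous u)
    (hi : Integrable fun x : ℝ => (1 + |x|) * |u x|) (x : ℝ) :
    HasDerivAt (weightTail u) (-((1 + |x|) * |u x|)) x :=
  hasDerivAt_integral_Ioi (continuous_weight hc) (fun _ => hi.integrableOn) x

theorem antitone_weightTail {u : ℝ → ℝ}
    (hi : Integrable fun x : ℝ => (1 + |x|) * |u x|) : Antitone (weightTail u) := by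
  intro x y hxy
  exact setIntegral_mono_set hi.integrableOn (Eventually.of_forall fun _ => by positivity)
    (Set.Ioi_subset_Ioi hxy).eventuallyLE

theorem tendsto_weightTail {u : ℝ → ℝ}
    (hi : Integrable fun x : ℝ => (1 + |x|) * |u x|) :
    Tendsto (weightTail u) atTop (𝓝 0) :=
  tendsto_integral_Ioi_atTop (a := 0) hi.integrableOn

theorem integrable_of_weight {u : ℝ → ℝ} (hc : Continuous u)
    (hi : Integrable fun x : ℝ => (1 + |x|) * |u x|) : Integrable u := by
  refine hi.mono hc.aestronglyMeasurable (Eventually.of_forall fun x => ?_)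
  rw [Real.norm_eq_abs, Real.norm_of_nonneg (by positivity)]
  nlinarith [mul_nonneg (abs_nonneg x) (abs_nonneg (u x))]

/-- The majorant of the Faddeev function on `[a, ∞)`. -/
def growthBound (u : ℝ → ℝ) (a x : ℝ) : ℝ := Real.exp (2 * (1 + |a|) * weightTail u x)

theorem one_le_growthBound (u : ℝ → ℝ) (a x : ℝ) : 1 ≤ growthBound u a x :=
  Real.one_le_exp (mul_nonneg (by positivity) (weightTail_nonneg u x))

theorem growthBound_nonneg (u : ℝ → ℝ) (a x : ℝ) : 0 ≤ growthBound u a x :=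
  Real.exp_nonneg _

theorem antitone_growthBound {u : ℝ → ℝ}
    (hi : Integrable fun x : ℝ => (1 + |x|) * |u x|) (a : ℝ) :
    Antitone (growthBound u a) := fun _ _ hxy =>
  Real.exp_le_exp.2 (mul_le_mul_of_nonneg_left (antitone_weightTail hi hxy) (by positivity))

theorem hasDerivAt_growthBound {u : ℝ → ℝ} (hc : Continuous u)
    (hi : Integrable fun x : ℝ => (1 + |x|) * |u x|) (a x : ℝ) :
    HasDerivAt (growthBound u a)
      (-(2 * ((1 + |a|) * ((1 + |x|) * |u x|) * growthBound u a x))) x := by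
  have h := ((hasDerivAt_weightTail hc hi x).const_mul (2 * (1 + |a|))).exp
  convert! h using 1
  unfold growthBound
  ring

theorem tendsto_growthBound {u : ℝ → ℝ}
    (hi : Integrable fun x : ℝ => (1 + |x|) * |u x|) (a : ℝ) :
    Tendsto (growthBound u a) atTop (𝓝 1) := by
  have h := ((tendsto_weightTail hi).const_mul (2 * (1 + |a|))).rexp
  rwa [mul_zero, Real.exp_zero] at h

theorem integrableOn_weight_growthBound {u : ℝ → ℝ} (hc : Continuous u)
    (hi : Integrable fun x : ℝ => (1 + |x|) * |u x|) (a x : ℝ) :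
    IntegrableOn (fun y => (1 + |a|) * ((1 + |y|) * |u y|) * growthBound u a y)
      (Set.Ioi x) := by
  have h := integrableOn_Ioi_deriv_of_nonpos' (a := x)
    (fun y _ => hasDerivAt_growthBound hc hi a y)
    (fun y _ => neg_nonpos.2 (mul_nonneg zero_le_two
      (mul_nonneg (by positivity) (growthBound_nonneg u a y)))) (tendsto_growthBound hi a)
  refine (h.const_mul (-(1 / 2))).congr (Eventually.of_forall fun y => ?_)
  ring

/-- The integrand is `-1/2` times the derivative of `growthBound u a`, so the integral equals
`(growthBound u a x - 1) / 2`. The factor `2` in the exponent is there to produce this `1/2`. -/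
theorem integral_weight_growthBound_le {u : ℝ → ℝ} (hc : Continuous u)
    (hi : Integrable fun x : ℝ => (1 + |x|) * |u x|) (a x : ℝ) :
    ∫ y in Set.Ioi x, (1 + |a|) * ((1 + |y|) * |u y|) * growthBound u a y ≤
      1 / 2 * growthBound u a x := by
  have h := integral_Ioi_of_hasDerivAt_of_nonpos' (a := x)
    (fun y _ => hasDerivAt_growthBound hc hi a y)
    (fun y _ => neg_nonpos.2 (mul_nonneg zero_le_two
      (mul_nonneg (by positivity) (growthBound_nonneg u a y)))) (tendsto_growthBound hi a)
  rw [integral_neg, integral_const_mul] at h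
  linarith

/-! ### The Volterra operator -/

theorem norm_volterraKernel_mul_le {u : ℝ → ℝ} {g : ℝ → ℂ} {b : ℝ → ℝ} {a x : ℝ} (hx : a ≤ x)
    (hg : ∀ y, a ≤ y → ‖g y‖ ≤ b y) (k : ℂ) (y : ℝ) :
    ‖volterraKernel k (y - x) * u y * g y‖ ≤
      (Set.Ioi x).indicator (fun y => (1 + |a|) * ((1 + |y|) * |u y|) * b y) y := by
  by_cases hy : y ∈ Set.Ioi x
  · rw [Set.indicator_of_mem hy, norm_mul, norm_mul, Complex.norm_real, Real.norm_eq_abs]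
    have hxy : x < y := hy
    have h1 := norm_volterraKernel_le k (y - x)
    rw [max_eq_left (by linarith)] at h1
    -- Since `a ≤ x`, `y - x ≤ |y| + |a|`; this is the origin of the factor `1 + |a|` in
    -- `growthBound`.
    have h2 : y - x ≤ (1 + |a|) * (1 + |y|) := by
      have := neg_abs_le a
      have := le_abs_self y
      nlinarith [mul_nonneg (abs_nonneg a) (abs_nonneg y)]
    have h3 := hg y (by linarith)
    rw [← mul_assoc (1 + |a|)]
    gcongr
    exact h1.trans h2
  · rw [Set.indicator_of_notMem hy, volterraKernel_of_nonpos]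
    · simp
    · simpa using hy

/-- The Volterra operator is a contraction with factor `1/2` for the sup norm on `[a, ∞)` weighted
by `growthBound u a`, whatever the size of `u`. -/
theorem norm_integral_volterraKernel_le {u : ℝ → ℝ} (hc : Continuous u)
    (hi : Integrable fun x : ℝ => (1 + |x|) * |u x|) {g : ℝ → ℂ} {C a x : ℝ} (hx : a ≤ x)
    (hg : ∀ y, a ≤ y → ‖g y‖ ≤ C * growthBound u a y) (k : ℂ) :
    ‖∫ y, volterraKernel k (y - x) * u y * g y‖ ≤ C * (1 / 2 * growthBound u a x) := by
  have hC : 0 ≤ C := by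
    have h := (norm_nonneg _).trans (hg a le_rfl)
    exact nonneg_of_mul_nonneg_left h (Real.exp_pos _)
  refine (norm_integral_le_of_norm_le (g := (Set.Ioi x).indicator
    fun y => (1 + |a|) * ((1 + |y|) * |u y|) * (C * growthBound u a y)) ?_ ?_).trans ?_
  · rw [integrable_indicator_iff measurableSet_Ioi]
    refine ((integrableOn_weight_growthBound hc hi a x).const_mul C).congr
      (Eventually.of_forall fun y => ?_)
    ring
  · exact Eventually.of_forall (norm_volterraKernel_mul_le hx hg k)
  · rw [integral_indicator measurableSet_Ioi]
    have : ∀ y, (1 + |a|) * ((1 + |y|) * |u y|) * (C * growthBound u a y) =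
        C * ((1 + |a|) * ((1 + |y|) * |u y|) * growthBound u a y) := fun y => by ring
    simp_rw [this]
    rw [integral_const_mul]
    exact mul_le_mul_of_nonneg_left (integral_weight_growthBound_le hc hi a x) hC

theorem norm_volterraKernel_mul_le_const {u : ℝ → ℝ} {g : ℝ → ℂ} {C a x : ℝ} (hx : a ≤ x)
    (hg : ∀ y, a ≤ y → ‖g y‖ ≤ C) (k : ℂ) (y : ℝ) :
    ‖volterraKernel k (y - x) * u y * g y‖ ≤ (1 + |a|) * ((1 + |y|) * |u y|) * C := by
  have hC : 0 ≤ C := (norm_nonneg _).trans (hg a le_rfl)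
  refine (norm_volterraKernel_mul_le hx hg k y).trans ?_
  exact Set.indicator_le_self' (fun _ _ => by positivity) y

theorem continuous_integral_volterraKernel {u : ℝ → ℝ} (hc : Continuous u)
    (hi : Integrable fun x : ℝ => (1 + |x|) * |u x|) {g : ℂ → ℝ → ℂ}
    (hg : Continuous (Function.uncurry g))
    (hb : ∀ a, ∃ C, ∀ k y, a ≤ y → ‖g k y‖ ≤ C) :
    Continuous (Function.uncurry
      fun (k : ℂ) (x : ℝ) => ∫ y, volterraKernel k (y - x) * u y * g k y) := by
  have hcont : Continuous fun q : (ℂ × ℝ) × ℝ =>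
      volterraKernel q.1.1 (q.2 - q.1.2) * (u q.2 : ℂ) * g q.1.1 q.2 := by
    have h1 : Continuous fun q : (ℂ × ℝ) × ℝ => volterraKernel q.1.1 (q.2 - q.1.2) :=
      continuous_volterraKernel.comp
        (f := fun q : (ℂ × ℝ) × ℝ => (q.1.1, q.2 - q.1.2)) (by fun_prop)
    have h2 : Continuous fun q : (ℂ × ℝ) × ℝ => g q.1.1 q.2 :=
      hg.comp (f := fun q : (ℂ × ℝ) × ℝ => (q.1.1, q.2)) (by fun_prop)
    have h3 : Continuous fun q : (ℂ × ℝ) × ℝ => (u q.2 : ℂ) := by fun_prop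
    exact (h1.mul h3).mul h2
  rw [continuous_iff_continuousAt]
  rintro ⟨k₀, x₀⟩
  -- A base point strictly to the left of `x₀` lets one dominating function serve for all `x` near
  -- `x₀`.
  obtain ⟨C, hC⟩ := hb (x₀ - 1)
  refine continuousAt_of_dominated
    (bound := fun y => (1 + |x₀ - 1|) * ((1 + |y|) * |u y|) * C) ?_ ?_ ?_ ?_
  · exact Eventually.of_forall fun p =>
      (hcont.comp (Continuous.prodMk_right p)).aestronglyMeasurable
  · have : ∀ᶠ p : ℂ × ℝ in 𝓝 (k₀, x₀), x₀ - 1 < p.2 :=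
      continuous_snd.continuousAt.eventually (lt_mem_nhds (by simp))
    filter_upwards [this] with p hp
    exact Eventually.of_forall
      (norm_volterraKernel_mul_le_const hp.le (fun y hy => hC p.1 y hy) p.1)
  · exact (hi.const_mul _).mul_const _
  · exact Eventually.of_forall fun y =>
      (hcont.comp (Continuous.prodMk_left y)).continuousAt

theorem differentiableOn_integral_volterraKernel {u : ℝ → ℝ} (hc : Continuous u)
    (hi : Integrable fun x : ℝ => (1 + |x|) * |u x|) {g : ℂ → ℝ → ℂ}
    (hg : Continuous (Function.uncurry g))
    (hb : ∀ a, ∃ C, ∀ k y, a ≤ y → ‖g k y‖ ≤ C)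
    (hd : ∀ y, DifferentiableOn ℂ (fun k => g k y) {k : ℂ | 0 < k.im}) (x : ℝ) :
    DifferentiableOn ℂ (fun k => ∫ y, volterraKernel k (y - x) * u y * g k y)
      {k : ℂ | 0 < k.im} := by
  obtain ⟨C, hC⟩ := hb x
  refine differentiableOn_integral_of_dominated isOpen_im_pos
    (f := fun k y => volterraKernel k (y - x) * u y * g k y)
    (b := fun y => (1 + |x|) * ((1 + |y|) * |u y|) * C) ?_ ?_ ?_ ?_
  · have h1 : Continuous fun q : ℂ × ℝ => volterraKernel q.1 (q.2 - x) :=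
      continuous_volterraKernel.comp (f := fun q : ℂ × ℝ => (q.1, q.2 - x)) (by fun_prop)
    have h3 : Continuous fun q : ℂ × ℝ => (u q.2 : ℂ) := by fun_prop
    exact (h1.mul h3).mul hg
  · exact fun y => ((differentiableOn_volterraKernel _).mul_const _).mul (hd y)
  · exact (hi.const_mul _).mul_const _
  · exact Eventually.of_forall fun y k _ =>
      norm_volterraKernel_mul_le_const le_rfl (fun y hy => hC k y hy) k y

/-! ### The Neumann series and the Faddeev function -/

/-- The terms of the Neumann series of the Faddeev function. -/
def neumannTerm (u : ℝ → ℝ) : ℕ → ℂ → ℝ → ℂ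
  | 0 => fun _ _ => 1
  | n + 1 => fun k x => -∫ y, volterraKernel k (y - x) * u y * neumannTerm u n k y

theorem norm_neumannTerm_le {u : ℝ → ℝ} (hc : Continuous u)
    (hi : Integrable fun x : ℝ => (1 + |x|) * |u x|) (n : ℕ) (k : ℂ) {a x : ℝ}
    (hx : a ≤ x) : ‖neumannTerm u n k x‖ ≤ (1 / 2) ^ n * growthBound u a x := by
  induction n generalizing x with
  | zero => simpa [neumannTerm] using one_le_growthBound u a x
  | succ n ih =>
    rw [neumannTerm, norm_neg, pow_succ, mul_assoc]
    exact norm_integral_volterraKernel_le hc hi hx (fun y hy => ih hy) k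

theorem norm_neumannTerm_le_const {u : ℝ → ℝ} (hc : Continuous u)
    (hi : Integrable fun x : ℝ => (1 + |x|) * |u x|) (n : ℕ) (k : ℂ) {a x : ℝ}
    (hx : a ≤ x) : ‖neumannTerm u n k x‖ ≤ (1 / 2) ^ n * growthBound u a a :=
  (norm_neumannTerm_le hc hi n k hx).trans
    (mul_le_mul_of_nonneg_left (antitone_growthBound hi a hx) (by positivity))

theorem continuous_neumannTerm {u : ℝ → ℝ} (hc : Continuous u)
    (hi : Integrable fun x : ℝ => (1 + |x|) * |u x|) (n : ℕ) :
    Continuous (Function.uncurry (neumannTerm u n)) := by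
  induction n with
  | zero => exact continuous_const
  | succ n ih =>
    exact (continuous_integral_volterraKernel hc hi ih fun a =>
      ⟨_, fun k y hy => norm_neumannTerm_le_const hc hi n k hy⟩).neg

theorem differentiableOn_neumannTerm {u : ℝ → ℝ} (hc : Continuous u)
    (hi : Integrable fun x : ℝ => (1 + |x|) * |u x|) (n : ℕ) (x : ℝ) :
    DifferentiableOn ℂ (fun k => neumannTerm u n k x) {k : ℂ | 0 < k.im} := by
  induction n generalizing x with
  | zero => exact differentiableOn_const _
  | succ n ih =>
    exact (differentiableOn_integral_volterraKernel hc hi (continuous_neumannTerm hc hi n)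
      (fun a => ⟨_, fun k y hy => norm_neumannTerm_le_const hc hi n k hy⟩) ih x).neg

/-- The Faddeev function `m (k, x)`: `exp (i k x) * m (k, x)` is the solution of the Schrödinger
equation that behaves like `exp (i k x)` as `x → ∞`. -/
def faddeevM (u : ℝ → ℝ) (k : ℂ) (x : ℝ) : ℂ := ∑' n, neumannTerm u n k x

theorem summable_half_pow_mul (C : ℝ) : Summable fun n : ℕ => (1 / 2 : ℝ) ^ n * C :=
  summable_geometric_two.mul_right C

theorem hasSum_neumannTerm {u : ℝ → ℝ} (hc : Continuous u)
    (hi : Integrable fun x : ℝ => (1 + |x|) * |u x|) (k : ℂ) (x : ℝ) :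
    HasSum (fun n => neumannTerm u n k x) (faddeevM u k x) :=
  (Summable.of_norm_bounded (summable_half_pow_mul _)
    fun n => norm_neumannTerm_le hc hi n k le_rfl).hasSum

theorem norm_faddeevM_le {u : ℝ → ℝ} (hc : Continuous u)
    (hi : Integrable fun x : ℝ => (1 + |x|) * |u x|) (k : ℂ) {a x : ℝ} (hx : a ≤ x) :
    ‖faddeevM u k x‖ ≤ 2 * growthBound u a a :=
  tsum_of_norm_bounded (hasSum_geometric_two.mul_right _)
    fun n => norm_neumannTerm_le_const hc hi n k hx

theorem continuous_faddeevM {u : ℝ → ℝ} (hc : Continuous u)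
    (hi : Integrable fun x : ℝ => (1 + |x|) * |u x|) :
    Continuous (Function.uncurry (faddeevM u)) := by
  rw [continuous_iff_continuousAt]
  rintro ⟨k₀, x₀⟩
  have h : ContinuousOn (Function.uncurry (faddeevM u)) {p | x₀ - 1 < p.2} :=
    continuousOn_tsum (f := fun n => Function.uncurry (neumannTerm u n))
      (fun n => (continuous_neumannTerm hc hi n).continuousOn)
      (summable_half_pow_mul _)
      (fun n p hp => norm_neumannTerm_le_const hc hi n p.1 (le_of_lt hp))
  refine h.continuousAt ((isOpen_lt continuous_const continuous_snd).mem_nhds ?_)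
  simp

theorem differentiableOn_faddeevM {u : ℝ → ℝ} (hc : Continuous u)
    (hi : Integrable fun x : ℝ => (1 + |x|) * |u x|) (x : ℝ) :
    DifferentiableOn ℂ (fun k => faddeevM u k x) {k : ℂ | 0 < k.im} :=
  Complex.differentiableOn_tsum_of_summable_norm (summable_half_pow_mul _)
    (fun n => differentiableOn_neumannTerm hc hi n x) isOpen_im_pos
    (fun n k _ => norm_neumannTerm_le_const hc hi n k le_rfl)

/-- The Volterra integral equation of the Faddeev function. -/
theorem faddeevM_eq {u : ℝ → ℝ} (hc : Continuous u)
    (hi : Integrable fun x : ℝ => (1 + |x|) * |u x|) (k : ℂ) (x : ℝ) :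
    faddeevM u k x = 1 - ∫ y, volterraKernel k (y - x) * u y * faddeevM u k y := by
  have h := hasSum_integral_of_dominated_convergence (μ := volume)
    (F := fun n y => volterraKernel k (y - x) * u y * neumannTerm u n k y)
    (f := fun y => volterraKernel k (y - x) * u y * faddeevM u k y)
    (fun n y => (1 + |x|) * ((1 + |y|) * |u y|) * ((1 / 2) ^ n * growthBound u x x))
    (fun n => ?_) (fun n => ?_) ?_ ?_ ?_
  · have h2 := (hasSum_nat_add_iff' 1).2 (hasSum_neumannTerm hc hi k x)
    have h3 := h2.unique h.neg
    simp only [Finset.range_one, Finset.sum_singleton, neumannTerm] at h3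
    linear_combination h3
  · have h1 : Continuous fun y : ℝ => volterraKernel k (y - x) :=
      continuous_volterraKernel.comp (f := fun y : ℝ => (k, y - x)) (by fun_prop)
    have h3 : Continuous fun y : ℝ => (u y : ℂ) := by fun_prop
    exact ((h1.mul h3).mul ((continuous_neumannTerm hc hi n).comp
      (Continuous.prodMk_right k))).aestronglyMeasurable
  · exact Eventually.of_forall fun y => norm_volterraKernel_mul_le_const le_rfl
      (fun y hy => norm_neumannTerm_le_const hc hi n k hy) k y
  · exact Eventually.of_forall fun y => (summable_half_pow_mul _).mul_left _
  · simp_rw [tsum_mul_left]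
    exact (hi.const_mul _).mul_const _
  · exact Eventually.of_forall fun y => (hasSum_neumannTerm hc hi k y).mul_left _

theorem abs_le_weight (u : ℝ → ℝ) (y : ℝ) : |u y| ≤ (1 + |y|) * |u y| :=
  le_mul_of_one_le_left (abs_nonneg _) (by linarith [abs_nonneg y])

theorem norm_faddeevM_sub_one_le {u : ℝ → ℝ} (hc : Continuous u)
    (hi : Integrable fun x : ℝ => (1 + |x|) * |u x|) (k : ℂ) {x : ℝ} (hx : 0 ≤ x) :
    ‖faddeevM u k x - 1‖ ≤ weightTail u x * (2 * growthBound u 0 0) := by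
  rw [faddeevM_eq hc hi, sub_sub_cancel_left, norm_neg]
  refine (norm_integral_le_of_norm_le ?_ (Eventually.of_forall
    (norm_volterraKernel_mul_le hx (fun y hy => norm_faddeevM_le hc hi k hy) k))).trans ?_
  · rw [integrable_indicator_iff measurableSet_Ioi]
    exact ((hi.const_mul _).mul_const _).integrableOn
  · rw [integral_indicator measurableSet_Ioi, integral_mul_const, integral_const_mul]
    simp [weightTail]

theorem tendsto_faddeevM_atTop {u : ℝ → ℝ} (hc : Continuous u)
    (hi : Integrable fun x : ℝ => (1 + |x|) * |u x|) (k : ℂ) :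
    Tendsto (faddeevM u k) atTop (𝓝 1) := by
  rw [tendsto_iff_norm_sub_tendsto_zero]
  refine squeeze_zero' (Eventually.of_forall fun _ => norm_nonneg _) ?_
    (by simpa using (tendsto_weightTail hi).mul_const (2 * growthBound u 0 0))
  filter_upwards [eventually_ge_atTop 0] with x hx
  exact norm_faddeevM_sub_one_le hc hi k hx

/-- Here the kernel is estimated by `‖k‖⁻¹` instead of `y - x`, and the bound on `faddeevM` does not
depend on `k`. All the limits at infinity in `k` rest on this decay. -/
theorem norm_faddeevM_sub_one_le_div {u : ℝ → ℝ} (hc : Continuous u)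
    (hi : Integrable fun x : ℝ => (1 + |x|) * |u x|) {k : ℂ} (hk : 0 ≤ k.im) (h0 : k ≠ 0)
    (x : ℝ) :
    ‖faddeevM u k x - 1‖ ≤ ((∫ y, |u y|) * (2 * growthBound u x x)) / ‖k‖ := by
  rw [faddeevM_eq hc hi, sub_sub_cancel_left, norm_neg]
  have hint : Integrable fun y => ‖k‖⁻¹ * (|u y| * (2 * growthBound u x x)) :=
    ((integrable_of_weight hc hi).abs.mul_const _).const_mul _
  refine (norm_integral_le_of_norm_le hint (Eventually.of_forall fun y => ?_)).trans ?_
  · have hG := growthBound_nonneg u x x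
    rcases le_total y x with hy | hy
    · rw [volterraKernel_of_nonpos k (by linarith), zero_mul, zero_mul, norm_zero]
      positivity
    · rw [norm_mul, norm_mul, Complex.norm_real, Real.norm_eq_abs, ← mul_assoc]
      gcongr
      · exact norm_volterraKernel_le_inv hk h0 _
      · exact norm_faddeevM_le hc hi k hy
  · rw [integral_const_mul, integral_mul_const, div_eq_inv_mul]

/-! ### The derivative in `x` and the differential equation -/

/-- The derivative of the Faddeev function with respect to `x`. -/
def faddeevDeriv (u : ℝ → ℝ) (k : ℂ) (x : ℝ) : ℂ :=
  ∫ y in Set.Ioi x, Complex.exp (2 * Complex.I * upperProj k * ((max (y - x) 0 : ℝ) : ℂ)) *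
    (u y * faddeevM u k y)

theorem norm_faddeevDeriv_integrand_le {u : ℝ → ℝ} (hc : Continuous u)
    (hi : Integrable fun x : ℝ => (1 + |x|) * |u x|) (k : ℂ) {a x y : ℝ} (hy : a ≤ y) :
    ‖Complex.exp (2 * Complex.I * upperProj k * ((max (y - x) 0 : ℝ) : ℂ)) *
      (u y * faddeevM u k y)‖ ≤ (1 + |y|) * |u y| * (2 * growthBound u a a) := by
  rw [norm_mul, norm_mul, Complex.norm_exp, Complex.norm_real, Real.norm_eq_abs]
  have h1 := Real.exp_le_one_iff.2 (re_two_I_mul_nonpos k (le_max_right (y - x) 0))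
  refine (mul_le_of_le_one_left (by positivity) h1).trans ?_
  exact mul_le_mul (abs_le_weight u y) (norm_faddeevM_le hc hi k hy) (norm_nonneg _)
    (by positivity)

theorem norm_faddeevDeriv_le {u : ℝ → ℝ} (hc : Continuous u)
    (hi : Integrable fun x : ℝ => (1 + |x|) * |u x|) (k : ℂ) {a x : ℝ} (hx : a ≤ x) :
    ‖faddeevDeriv u k x‖ ≤ weightTail u x * (2 * growthBound u a a) := by
  rw [weightTail, ← integral_mul_const]
  refine norm_integral_le_of_norm_le (hi.mul_const _).integrableOn ?_
  refine (ae_restrict_iff' measurableSet_Ioi).2 (Eventually.of_forall fun y hy => ?_)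
  exact norm_faddeevDeriv_integrand_le hc hi k (hx.trans (le_of_lt hy))

theorem tendsto_faddeevDeriv_atTop {u : ℝ → ℝ} (hc : Continuous u)
    (hi : Integrable fun x : ℝ => (1 + |x|) * |u x|) (k : ℂ) :
    Tendsto (faddeevDeriv u k) atTop (𝓝 0) := by
  rw [tendsto_zero_iff_norm_tendsto_zero]
  refine squeeze_zero' (Eventually.of_forall fun _ => norm_nonneg _) ?_
    (by simpa using (tendsto_weightTail hi).mul_const (2 * growthBound u 0 0))
  filter_upwards [eventually_ge_atTop 0] with x hx
  exact norm_faddeevDeriv_le hc hi k hx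

theorem continuous_faddeevDeriv_integrand {u : ℝ → ℝ} (hc : Continuous u)
    (hi : Integrable fun x : ℝ => (1 + |x|) * |u x|) (x : ℝ) :
    Continuous (Function.uncurry fun (k : ℂ) (y : ℝ) =>
      Complex.exp (2 * Complex.I * upperProj k * ((max (y - x) 0 : ℝ) : ℂ)) *
        (u y * faddeevM u k y)) := by
  have h1 := continuous_upperProj
  have h2 : Continuous fun q : ℂ × ℝ => faddeevM u q.1 q.2 := continuous_faddeevM hc hi
  unfold Function.uncurry
  fun_prop

theorem continuous_faddeevDeriv {u : ℝ → ℝ} (hc : Continuous u)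
    (hi : Integrable fun x : ℝ => (1 + |x|) * |u x|) (x : ℝ) :
    Continuous fun k => faddeevDeriv u k x := by
  have hcont := continuous_faddeevDeriv_integrand hc hi x
  refine continuous_of_dominated
    (bound := fun y => (1 + |y|) * |u y| * (2 * growthBound u x x)) ?_ ?_ ?_ ?_
  · exact fun k => (hcont.comp (Continuous.prodMk_right k)).aestronglyMeasurable
  · exact fun k => (ae_restrict_iff' measurableSet_Ioi).2 (Eventually.of_forall fun y hy =>
      norm_faddeevDeriv_integrand_le hc hi k (le_of_lt hy))
  · exact (hi.mul_const _).integrableOn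
  · exact Eventually.of_forall fun y => hcont.comp (Continuous.prodMk_left y)

theorem differentiableOn_faddeevDeriv {u : ℝ → ℝ} (hc : Continuous u)
    (hi : Integrable fun x : ℝ => (1 + |x|) * |u x|) (x : ℝ) :
    DifferentiableOn ℂ (fun k => faddeevDeriv u k x) {k : ℂ | 0 < k.im} := by
  refine differentiableOn_integral_of_dominated isOpen_im_pos
    (b := fun y => (1 + |y|) * |u y| * (2 * growthBound u x x))
    (continuous_faddeevDeriv_integrand hc hi x) ?_ (hi.mul_const _).integrableOn ?_
  · exact fun y => ((differentiableOn_upperProj.const_mul _).mul_const _).cexp.mul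
      ((differentiableOn_faddeevM hc hi y).const_mul _)
  · exact (ae_restrict_iff' measurableSet_Ioi).2 (Eventually.of_forall fun y hy k _ =>
      norm_faddeevDeriv_integrand_le hc hi k (le_of_lt hy))

theorem continuous_faddeevM_right {u : ℝ → ℝ} (hc : Continuous u)
    (hi : Integrable fun x : ℝ => (1 + |x|) * |u x|) (k : ℂ) : Continuous (faddeevM u k) :=
  (continuous_faddeevM hc hi).comp (Continuous.prodMk_right k)

theorem continuous_faddeevM_left {u : ℝ → ℝ} (hc : Continuous u)
    (hi : Integrable fun x : ℝ => (1 + |x|) * |u x|) (x : ℝ) :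
    Continuous fun k => faddeevM u k x :=
  (continuous_faddeevM hc hi).comp (Continuous.prodMk_left x)

theorem integrableOn_mul_faddeevM {u : ℝ → ℝ} (hc : Continuous u)
    (hi : Integrable fun x : ℝ => (1 + |x|) * |u x|) (k : ℂ) {h : ℝ → ℂ} (hh : Continuous h)
    (hb : ∀ y, ‖h y‖ ≤ 1 + |y|) (a : ℝ) :
    IntegrableOn (fun y => h y * (u y * faddeevM u k y)) (Set.Ioi a) := by
  have hm := continuous_faddeevM_right hc hi k
  refine Integrable.mono' (hi.mul_const (2 * growthBound u a a)).integrableOn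
    (Continuous.aestronglyMeasurable (by fun_prop)) ?_
  refine (ae_restrict_iff' measurableSet_Ioi).2 (Eventually.of_forall fun y hy => ?_)
  have hy' : a ≤ y := le_of_lt hy
  rw [norm_mul, norm_mul, Complex.norm_real, Real.norm_eq_abs, mul_assoc]
  gcongr
  · exact hb y
  · exact norm_faddeevM_le hc hi k hy'

theorem norm_exp_two_I_mul_real (k y : ℝ) :
    ‖Complex.exp (2 * Complex.I * (k : ℂ) * (y : ℂ))‖ = 1 := by
  have : 2 * Complex.I * (k : ℂ) * (y : ℂ) = ((2 * k * y : ℝ) : ℂ) * Complex.I := by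
    push_cast
    ring
  rw [this, Complex.norm_exp_ofReal_mul_I]

theorem upperProj_ofReal (k : ℝ) : upperProj k = k := upperProj_of_im_nonneg (by simp)

theorem exp_two_I_mul_sub (k x y : ℝ) :
    Complex.exp (2 * Complex.I * k * ((y - x : ℝ) : ℂ)) =
      Complex.exp (-(2 * Complex.I * k * x)) * Complex.exp (2 * Complex.I * k * y) := by
  rw [← Complex.exp_add]
  congr 1
  push_cast
  ring

/-- For real `k` the exponential splits into a factor in `x` and a unimodular factor in `y`, so that
differentiation in `x` needs only the product rule and the fundamental theorem of calculus. -/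
theorem faddeevDeriv_ofReal (u : ℝ → ℝ) (k x : ℝ) :
    faddeevDeriv u k x = Complex.exp (-(2 * Complex.I * k * x)) *
      ∫ y in Set.Ioi x, Complex.exp (2 * Complex.I * (k : ℂ) * (y : ℂ)) *
        (u y * faddeevM u k y) := by
  rw [faddeevDeriv, ← integral_const_mul]
  refine setIntegral_congr_fun measurableSet_Ioi fun y hy => ?_
  have hy' : x < y := hy
  rw [upperProj_ofReal, max_eq_left (by linarith), exp_two_I_mul_sub, mul_assoc]

theorem hasDerivAt_faddeevDeriv {u : ℝ → ℝ} (hc : Continuous u)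
    (hi : Integrable fun x : ℝ => (1 + |x|) * |u x|) (k x : ℝ) :
    HasDerivAt (faddeevDeriv u k)
      (-(2 * Complex.I * k) * faddeevDeriv u k x - u x * faddeevM u k x) x := by
  have hm := continuous_faddeevM_right hc hi k
  have h1 := hasDerivAt_integral_Ioi
    (f := fun y : ℝ => Complex.exp (2 * Complex.I * (k : ℂ) * (y : ℂ)) *
        (u y * faddeevM u k y)) (by fun_prop)
    (integrableOn_mul_faddeevM hc hi k (by fun_prop) fun y => by
      rw [norm_exp_two_I_mul_real]
      linarith [abs_nonneg y]) x
  have h2 : HasDerivAt (fun x : ℝ => Complex.exp (-(2 * Complex.I * k * x)))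
      (Complex.exp (-(2 * Complex.I * k * x)) * -(2 * Complex.I * k)) x := by
    have h3 := ((hasDerivAt_id x).ofReal_comp.const_mul (2 * Complex.I * (k : ℂ))).neg.cexp
    simpa using h3
  have h4 := h2.mul h1
  have h5 : (faddeevDeriv u k) = fun x : ℝ => Complex.exp (-(2 * Complex.I * k * x)) *
      ∫ y in Set.Ioi x, Complex.exp (2 * Complex.I * (k : ℂ) * (y : ℂ)) *
        (u y * faddeevM u k y) := funext fun x => faddeevDeriv_ofReal u k x
  have h6 : Complex.exp (-(2 * Complex.I * k * x)) * Complex.exp (2 * Complex.I * k * x) = 1 := by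
    rw [← Complex.exp_add]
    simp
  rw [faddeevDeriv_ofReal, h5]
  convert! h4 using 1
  linear_combination (-(u x * faddeevM u k x)) * (-h6)

theorem integral_volterraKernel_eq_setIntegral (u : ℝ → ℝ) (k : ℂ) (g : ℝ → ℂ) (x : ℝ) :
    ∫ y, volterraKernel k (y - x) * u y * g y =
      ∫ y in Set.Ioi x, volterraKernel k (y - x) * u y * g y := by
  refine (setIntegral_eq_integral_of_forall_compl_eq_zero fun y hy => ?_).symm
  rw [volterraKernel_of_nonpos]
  · simp
  · simpa using hy

/-- In the Volterra equation the kernel is split into terms whose `x`-dependence factors out: `y -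
x` if `k = 0`, and otherwise the two terms of `(exp (2 i k (y - x)) - 1) / (2 i k)`. The boundary
terms cancel on differentiation. -/
theorem hasDerivAt_faddeevM {u : ℝ → ℝ} (hc : Continuous u)
    (hi : Integrable fun x : ℝ => (1 + |x|) * |u x|) (k x : ℝ) :
    HasDerivAt (faddeevM u k) (faddeevDeriv u k x) x := by
  have hm := continuous_faddeevM_right hc hi k
  have hi1 := integrableOn_mul_faddeevM hc hi k (h := fun _ => 1) (by fun_prop) fun y => by
    simp
  have hI := hasDerivAt_integral_Ioi (f := fun y : ℝ => 1 * (u y * faddeevM u k y))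
    (by fun_prop) hi1 x
  rcases eq_or_ne k 0 with rfl | h0
  · have hiy := integrableOn_mul_faddeevM hc hi (0 : ℝ) (h := fun y => (y : ℂ)) (by fun_prop)
      fun y => by simp
    have hJ := hasDerivAt_integral_Ioi
      (f := fun y : ℝ => (y : ℂ) * (u y * faddeevM u (0 : ℝ) y)) (by fun_prop) hiy x
    have hM : faddeevM u (0 : ℝ) = fun x : ℝ => 1 -
        ((∫ y in Set.Ioi x, (y : ℂ) * (u y * faddeevM u (0 : ℝ) y)) -
          x * ∫ y in Set.Ioi x, 1 * (u y * faddeevM u (0 : ℝ) y)) := by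
      funext x
      rw [← integral_const_mul, ← integral_sub (hiy x) ((hi1 x).const_mul _),
        faddeevM_eq hc hi, integral_volterraKernel_eq_setIntegral]
      congr 1
      refine setIntegral_congr_fun measurableSet_Ioi fun y hy => ?_
      have hy' : x < y := hy
      simp only [Complex.ofReal_zero]
      rw [volterraKernel_zero (by linarith)]
      push_cast
      ring
    have hx := (hasDerivAt_id x).ofReal_comp
    have h := (hJ.sub (hx.mul hI)).const_sub 1
    rw [hM]
    convert! h using 1
    rw [faddeevDeriv_ofReal]
    simp
  · have hkC : (k : ℂ) ≠ 0 := Complex.ofReal_ne_zero.2 h0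
    have hk0 : 2 * Complex.I * (k : ℂ) ≠ 0 := by simp [h0]
    have hM : faddeevM u k = fun x : ℝ => 1 - (2 * Complex.I * (k : ℂ))⁻¹ *
        (faddeevDeriv u k x - ∫ y in Set.Ioi x, 1 * (u y * faddeevM u k y)) := by
      funext x
      have hie := integrableOn_mul_faddeevM hc hi k
        (h := fun y => Complex.exp (2 * Complex.I * k * y)) (by fun_prop) (fun y => by
          rw [norm_exp_two_I_mul_real]
          linarith [abs_nonneg y]) x
      rw [faddeevDeriv_ofReal, ← integral_const_mul,
        ← integral_sub (hie.const_mul _) (hi1 x), ← integral_const_mul,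
        faddeevM_eq hc hi, integral_volterraKernel_eq_setIntegral]
      congr 1
      refine setIntegral_congr_fun measurableSet_Ioi fun y hy => ?_
      have hy' : x < y := hy
      have h1 := two_I_mul_volterraKernel (k := (k : ℂ)) (by simp) (t := y - x) (by linarith)
      rw [exp_two_I_mul_sub] at h1
      rw [eq_inv_mul_iff_mul_eq₀ hk0]
      linear_combination (u y * faddeevM u k y) * h1
    have h := (((hasDerivAt_faddeevDeriv hc hi k x).sub hI).const_mul
      (2 * Complex.I * (k : ℂ))⁻¹).const_sub 1
    rw [hM]
    convert! h using 1
    field_simp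
    ring

/-! ### Solutions of the Schrödinger equation and Wronskians -/

theorem isSchrodingerSolution_of_hasDerivAt {u : ℝ → ℝ} (hc : Continuous u) {k : ℝ}
    {v v' : ℝ → ℂ} (h1 : ∀ x, HasDerivAt v (v' x) x)
    (h2 : ∀ x, HasDerivAt v' (-(u x + (k : ℂ) ^ 2) * v x) x) :
    IsSchrodingerSolution u k v := by
  have hd : deriv v = v' := funext fun x => (h1 x).deriv
  have hd' : deriv v' = fun x => -(u x + (k : ℂ) ^ 2) * v x := funext fun x => (h2 x).deriv
  have hv : Differentiable ℝ v := fun x => (h1 x).differentiableAt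
  refine ⟨?_, fun x => ?_⟩
  · rw [show (2 : WithTop ℕ∞) = 1 + 1 by norm_num, contDiff_succ_iff_deriv, hd]
    refine ⟨hv, by simp, ?_⟩
    rw [contDiff_one_iff_deriv, hd']
    have := hv.continuous
    exact ⟨fun x => (h2 x).differentiableAt, by fun_prop⟩
  · rw [iteratedDeriv_succ, iteratedDeriv_one, hd, hd']
    ring

namespace IsSchrodingerSolution

variable {u : ℝ → ℝ} {k : ℝ} {v w : ℝ → ℂ}

theorem hasDerivAt (hv : IsSchrodingerSolution u k v) (x : ℝ) :
    HasDerivAt v (deriv v x) x :=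
  (hv.1.differentiable (by norm_num) x).hasDerivAt

theorem hasDerivAt_deriv (hv : IsSchrodingerSolution u k v) (x : ℝ) :
    HasDerivAt (deriv v) (-(u x + (k : ℂ) ^ 2) * v x) x := by
  have h := hv.1
  rw [show (2 : WithTop ℕ∞) = 1 + 1 by norm_num, contDiff_succ_iff_deriv] at h
  have h2 := (h.2.2.differentiable (by norm_num) x).hasDerivAt
  have h3 := hv.2 x
  rw [iteratedDeriv_succ, iteratedDeriv_one] at h3
  convert! h2 using 1
  linear_combination -h3

theorem sub (hc : Continuous u) (hv : IsSchrodingerSolution u k v)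
    (hw : IsSchrodingerSolution u k w) : IsSchrodingerSolution u k (v - w) := by
  refine isSchrodingerSolution_of_hasDerivAt hc
    (fun x => (hv.hasDerivAt x).sub (hw.hasDerivAt x)) fun x => ?_
  convert! (hv.hasDerivAt_deriv x).sub (hw.hasDerivAt_deriv x) using 1
  simp only [Pi.sub_apply]
  ring

theorem const_mul (hc : Continuous u) (hv : IsSchrodingerSolution u k v) (c : ℂ) :
    IsSchrodingerSolution u k (fun x => c * v x) := by
  refine isSchrodingerSolution_of_hasDerivAt hc
    (fun x => (hv.hasDerivAt x).const_mul c) fun x => ?_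
  convert! (hv.hasDerivAt_deriv x).const_mul c using 1
  ring

theorem comp_neg (hc : Continuous u) (hv : IsSchrodingerSolution u k v) {l : ℝ}
    (hl : l ^ 2 = k ^ 2) :
    IsSchrodingerSolution (fun x => u (-x)) l (fun x => v (-x)) := by
  have hl' : (l : ℂ) ^ 2 = (k : ℂ) ^ 2 := by exact_mod_cast hl
  refine isSchrodingerSolution_of_hasDerivAt (v' := fun x => -deriv v (-x)) (by fun_prop)
    (fun x => ?_) fun x => ?_
  · simpa [Function.comp_def] using! (hv.hasDerivAt (-x)).scomp x (hasDerivAt_neg x)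
  · have h := ((hv.hasDerivAt_deriv (-x)).scomp x (hasDerivAt_neg x)).neg
    convert! h using 1
    rw [hl']
    simp

end IsSchrodingerSolution

/-- The Wronskian `v w' - v' w`. -/
def wronskian (v w : ℝ → ℂ) (x : ℝ) : ℂ := v x * deriv w x - deriv v x * w x

namespace IsSchrodingerSolution

variable {u : ℝ → ℝ} {k : ℝ} {v w : ℝ → ℂ}

theorem wronskian_eq (hv : IsSchrodingerSolution u k v) (hw : IsSchrodingerSolution u k w)
    (x y : ℝ) : wronskian v w x = wronskian v w y := by
  have h : ∀ x, HasDerivAt (wronskian v w) 0 x := fun x => by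
    have h1 := ((hv.hasDerivAt x).mul (hw.hasDerivAt_deriv x)).sub
      ((hv.hasDerivAt_deriv x).mul (hw.hasDerivAt x))
    convert! h1 using 1
    ring
  exact is_const_of_deriv_eq_zero (fun x => (h x).differentiableAt) (fun x => (h x).deriv) x y

theorem wronskian_eq_of_tendsto (hv : IsSchrodingerSolution u k v)
    (hw : IsSchrodingerSolution u k w) {c : ℂ} (h : Tendsto (wronskian v w) atTop (𝓝 c))
    (x : ℝ) : wronskian v w x = c := by
  refine tendsto_nhds_unique (tendsto_const_nhds (f := atTop (α := ℝ))) (h.congr fun y => ?_)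
  exact hv.wronskian_eq hw y x

theorem eq_zero_of_initial (hc : Continuous u) (hv : IsSchrodingerSolution u k v) {x₀ : ℝ}
    (h0 : v x₀ = 0) (h1 : deriv v x₀ = 0) (x : ℝ) : v x = 0 := by
  obtain ⟨a, b, hx, hx₀⟩ : ∃ a b, x ∈ Set.Ioo a b ∧ x₀ ∈ Set.Ioo a b := by
    refine ⟨min x x₀ - 1, max x x₀ + 1, ?_⟩
    grind
  -- On a compact interval `u + k²` is bounded by some `C`, and the first-order system for `(v, v')`
  -- is then Lipschitz with constant `max 1 C` in the sup norm.
  obtain ⟨C, hC⟩ := (isCompact_Icc (a := a) (b := b)).exists_bound_of_continuousOn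
    (f := fun t => (u t + (k : ℂ) ^ 2)) (by fun_prop)
  let F : ℝ → ℂ × ℂ → ℂ × ℂ := fun t p => (p.2, -(u t + (k : ℂ) ^ 2) * p.1)
  have hF : ∀ t ∈ Set.Ioo a b, LipschitzOnWith (Real.toNNReal (max 1 C)) (F t) Set.univ := by
    intro t ht
    refine LipschitzOnWith.of_dist_le_mul fun p _ q _ => ?_
    rw [Real.coe_toNNReal _ (zero_le_one.trans (le_max_left _ _)), dist_eq_norm, dist_eq_norm]
    have hpq : F t p - F t q = ((p - q).2, -(u t + (k : ℂ) ^ 2) * (p - q).1) := by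
      ext <;> simp [F]
      ring
    have hfst := norm_fst_le (p - q)
    have hsnd := norm_snd_le (p - q)
    have hM : 0 ≤ max 1 C := zero_le_one.trans (le_max_left _ _)
    rw [hpq, Prod.norm_def, max_le_iff]
    constructor
    · exact hsnd.trans (le_mul_of_one_le_left (norm_nonneg _) (le_max_left _ _))
    · simp only
      rw [norm_mul, norm_neg]
      have := (hC t (Set.Ioo_subset_Icc_self ht)).trans (le_max_right 1 C)
      gcongr
  have h := ODE_solution_unique_of_mem_Ioo (f := fun t => (v t, deriv v t))
    (g := fun _ => (0 : ℂ × ℂ)) hF hx₀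
    (fun t _ => ⟨(hv.hasDerivAt t).prodMk (hv.hasDerivAt_deriv t), trivial⟩)
    (fun t _ => ⟨by simpa [F] using! hasDerivAt_const t (0 : ℂ × ℂ), trivial⟩)
    (by simp [h0, h1]) hx
  exact congrArg Prod.fst h

/-- Taylor's formula on `[x, x + 1]` expresses `v' x` by `v (x + 1)`, `v x` and an integral of `v''
= -(u + k²) v`; the integral is small because `v` is small and `|u| + k²` has bounded integral over
unit intervals. -/
theorem tendsto_deriv_zero (hc : Continuous u) (hi : Integrable u)
    (hv : IsSchrodingerSolution u k v) (h : Tendsto v atTop (𝓝 0)) :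
    Tendsto (deriv v) atTop (𝓝 0) := by
  have hvc : Continuous v := hv.1.continuous
  have key : ∀ x, v (x + 1) - v x - deriv v x =
      ∫ y in x..(x + 1), ((x + 1 - y : ℝ) : ℂ) * (-(u y + (k : ℂ) ^ 2) * v y) := by
    intro x
    have h1 : ∀ y ∈ Set.uIcc x (x + 1),
        HasDerivAt (fun y : ℝ => v y + ((x + 1 - y : ℝ) : ℂ) * deriv v y)
          (((x + 1 - y : ℝ) : ℂ) * (-(u y + (k : ℂ) ^ 2) * v y)) y := by
      intro y _
      have h2 := ((hasDerivAt_id y).const_sub (x + 1)).ofReal_comp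
      have h3 := (hv.hasDerivAt y).add (h2.mul (hv.hasDerivAt_deriv y))
      convert! h3 using 1
      simp
    rw [intervalIntegral.integral_eq_sub_of_hasDerivAt h1
      (Continuous.intervalIntegrable (by fun_prop) _ _)]
    simp
    ring
  have hI : Tendsto (fun x => ∫ y in x..(x + 1),
      ((x + 1 - y : ℝ) : ℂ) * (-(u y + (k : ℂ) ^ 2) * v y)) atTop (𝓝 0) := by
    -- `D` strictly exceeds the integral of `|u| + k²` over any unit interval, and the summand `1`
    -- keeps it positive.
    set D := (∫ y, |u y|) + k ^ 2 + 1 with hD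
    have hu0 : 0 ≤ ∫ y, |u y| := integral_nonneg fun _ => abs_nonneg _
    have hD0 : 0 < D := by positivity
    rw [Metric.tendsto_atTop] at h ⊢
    intro ε hε
    obtain ⟨R, hR⟩ := h (ε / D) (by positivity)
    refine ⟨R, fun x hx => ?_⟩
    rw [dist_zero_right]
    have hxx : x ≤ x + 1 := by linarith
    have hle : ‖∫ y in x..(x + 1), ((x + 1 - y : ℝ) : ℂ) * (-(u y + (k : ℂ) ^ 2) * v y)‖ ≤
        ∫ y in x..(x + 1), (|u y| + k ^ 2) * (ε / D) := by
      refine intervalIntegral.norm_integral_le_of_norm_le hxx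
        (Eventually.of_forall fun y hy => ?_)
        (Continuous.intervalIntegrable (by fun_prop) _ _)
      have h4 : ‖v y‖ ≤ ε / D := by
        have := hR y (by linarith [hy.1])
        rw [dist_zero_right] at this
        exact this.le
      rw [norm_mul, norm_mul, norm_neg, Complex.norm_real, Real.norm_eq_abs,
        abs_of_nonneg (by linarith [hy.2])]
      have h5 : ‖(u y : ℂ) + (k : ℂ) ^ 2‖ ≤ |u y| + k ^ 2 := by
        refine (norm_add_le _ _).trans_eq ?_
        simp
      refine (mul_le_of_le_one_left (by positivity) (by linarith [hy.1])).trans ?_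
      gcongr
    refine hle.trans_lt ?_
    rw [intervalIntegral.integral_mul_const, intervalIntegral.integral_add
      (Continuous.intervalIntegrable (by fun_prop) _ _) (by simp)]
    have h6 : ∫ y in x..(x + 1), |u y| ≤ ∫ y, |u y| := by
      rw [intervalIntegral.integral_of_le hxx]
      exact setIntegral_le_integral hi.abs (Eventually.of_forall fun _ => abs_nonneg _)
    have h7 : ((∫ y in x..(x + 1), |u y|) + ∫ _ in x..(x + 1), k ^ 2) < D := by
      rw [intervalIntegral.integral_const, hD]
      simp only [add_sub_cancel_left, one_smul]
      linarith
    calc _ < D * (ε / D) := by gcongr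
      _ = ε := by field_simp
  have h1 : Tendsto (fun x => v (x + 1)) atTop (𝓝 0) :=
    h.comp (tendsto_atTop_add_const_right _ _ tendsto_id)
  have h2 := (h1.sub h).sub hI
  simp only [sub_zero] at h2
  refine h2.congr fun x => ?_
  rw [← key]
  ring

end IsSchrodingerSolution

/-! ### Jost solutions at `+∞` -/

theorem norm_exp_I_mul_real (k x : ℝ) :
    ‖Complex.exp (Complex.I * (k : ℂ) * (x : ℂ))‖ = 1 := by
  have : Complex.I * (k : ℂ) * (x : ℂ) = ((k * x : ℝ) : ℂ) * Complex.I := by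
    push_cast
    ring
  rw [this, Complex.norm_exp_ofReal_mul_I]

/-- The solution `exp (i k x) * m (k, x)` for real `k`. -/
def faddeevSolution (u : ℝ → ℝ) (k x : ℝ) : ℂ :=
  Complex.exp (Complex.I * (k : ℂ) * (x : ℂ)) * faddeevM u k x

theorem hasDerivAt_exp_I_mul (k x : ℝ) :
    HasDerivAt (fun x : ℝ => Complex.exp (Complex.I * (k : ℂ) * (x : ℂ)))
      (Complex.exp (Complex.I * (k : ℂ) * (x : ℂ)) * (Complex.I * k)) x := by
  simpa using ((hasDerivAt_id x).ofReal_comp.const_mul (Complex.I * (k : ℂ))).cexp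

section

variable {u : ℝ → ℝ} (hc : Continuous u) (hi : Integrable fun x : ℝ => (1 + |x|) * |u x|)

include hc hi

theorem hasDerivAt_faddeevSolution (k x : ℝ) :
    HasDerivAt (faddeevSolution u k) (Complex.exp (Complex.I * (k : ℂ) * (x : ℂ)) *
      (faddeevDeriv u k x + Complex.I * k * faddeevM u k x)) x := by
  convert! (hasDerivAt_exp_I_mul k x).mul (hasDerivAt_faddeevM hc hi k x) using 1
  ring

theorem deriv_faddeevSolution (k x : ℝ) :
    deriv (faddeevSolution u k) x = Complex.exp (Complex.I * (k : ℂ) * (x : ℂ)) *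
      (faddeevDeriv u k x + Complex.I * k * faddeevM u k x) :=
  (hasDerivAt_faddeevSolution hc hi k x).deriv

theorem isSchrodingerSolution_faddeevSolution (k : ℝ) :
    IsSchrodingerSolution u k (faddeevSolution u k) := by
  refine isSchrodingerSolution_of_hasDerivAt hc (hasDerivAt_faddeevSolution hc hi k)
    fun x => ?_
  convert! (hasDerivAt_exp_I_mul k x).mul ((hasDerivAt_faddeevDeriv hc hi k x).add
    ((hasDerivAt_faddeevM hc hi k x).const_mul (Complex.I * k))) using 1
  rw [faddeevSolution, Pi.add_apply]
  linear_combination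
    (-(k : ℂ) ^ 2 * Complex.exp (Complex.I * (k : ℂ) * (x : ℂ)) * faddeevM u k x) *
      Complex.I_sq

theorem isJostSolution_faddeevSolution (k : ℝ) :
    IsJostSolution u atTop k (faddeevSolution u k) := by
  refine ⟨isSchrodingerSolution_faddeevSolution hc hi k, isEquivalent_of_tendsto_one ?_⟩
  refine (tendsto_faddeevM_atTop hc hi k).congr fun x => ?_
  rw [Pi.div_apply, faddeevSolution, mul_div_cancel_left₀ _ (Complex.exp_ne_zero _)]

/-- Since `w` and `w'` tend to zero while the Faddeev solution and its derivative stay bounded, the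
constant Wronskian of the two is zero. Hence `w` is a multiple of the Faddeev solution, whose
modulus tends to one, so the multiple is zero. The argument includes `k = 0`. -/
theorem eq_zero_of_tendsto_zero {k : ℝ} {w : ℝ → ℂ} (hw : IsSchrodingerSolution u k w)
    (h : Tendsto w atTop (𝓝 0)) (x : ℝ) : w x = 0 := by
  have hs := isSchrodingerSolution_faddeevSolution hc hi k
  have hd := hw.tendsto_deriv_zero hc (integrable_of_weight hc hi) h
  have hm := tendsto_faddeevM_atTop hc hi k
  have hn := tendsto_faddeevDeriv_atTop hc hi k
  have hexp : ∀ f : ℝ → ℂ, Tendsto f atTop (𝓝 0) → Tendsto (fun x : ℝ => f x *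
      Complex.exp (Complex.I * (k : ℂ) * (x : ℂ))) atTop (𝓝 0) := by
    intro f hf
    rw [tendsto_zero_iff_norm_tendsto_zero] at hf ⊢
    simpa [norm_exp_I_mul_real] using hf
  have hW0 : Tendsto (wronskian w (faddeevSolution u k)) atTop (𝓝 0) := by
    have h1 := ((hexp w h).mul (hn.add (hm.const_mul (Complex.I * k)))).sub
      ((hexp _ hd).mul hm)
    simp only [zero_mul, sub_zero] at h1
    refine h1.congr fun x => ?_
    rw [wronskian, deriv_faddeevSolution hc hi, faddeevSolution]
    ring
  have hW := hw.wronskian_eq_of_tendsto hs hW0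
  obtain ⟨R, hR⟩ := (hm.eventually_ne one_ne_zero).exists
  have hsR : faddeevSolution u k R ≠ 0 := mul_ne_zero (Complex.exp_ne_zero _) hR
  -- With this `c` the difference vanishes at `R`; the vanishing Wronskian makes its derivative
  -- vanish there too.
  set c := w R / faddeevSolution u k R with hcdef
  have hz := hw.sub hc (hs.const_mul hc c)
  have hzd : deriv (w - fun x => c * faddeevSolution u k x) R = 0 := by
    rw [((hw.hasDerivAt R).sub ((hs.hasDerivAt R).const_mul c)).deriv, hcdef]
    have := hW R
    rw [wronskian] at this
    field_simp
    linear_combination -this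
  have hwc : ∀ y, w y = c * faddeevSolution u k y := fun y => sub_eq_zero.1
    (hz.eq_zero_of_initial hc (x₀ := R) (by simp [hcdef, hsR]) hzd y)
  have hc0 : c = 0 := by
    have h1 : Tendsto (fun y => ‖w y‖) atTop (𝓝 (‖c‖ * 1)) := by
      have h2 := hm.norm.const_mul ‖c‖
      rw [norm_one] at h2
      refine h2.congr fun y => ?_
      rw [hwc, norm_mul, faddeevSolution, norm_mul, norm_exp_I_mul_real, one_mul]
    have h3 := tendsto_nhds_unique h1 h.norm
    simpa using h3
  rw [hwc, hc0, zero_mul]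

theorem existsUnique_isJostSolution_atTop (k : ℝ) :
    ∃! v : ℝ → ℂ, IsJostSolution u atTop k v := by
  refine ⟨_, isJostSolution_faddeevSolution hc hi k, fun v hv => ?_⟩
  have hs := isJostSolution_faddeevSolution hc hi k
  have h : (v - faddeevSolution u k) =o[atTop]
      fun x : ℝ => Complex.exp (Complex.I * (k : ℂ) * (x : ℂ)) := by
    simpa [Pi.sub_def] using! hv.2.isLittleO.sub hs.2.isLittleO
  have h0 : Tendsto (v - faddeevSolution u k) atTop (𝓝 0) := by
    rw [← isLittleO_one_iff ℝ, ← isLittleO_norm_right] at *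
    simpa only [norm_exp_I_mul_real, norm_one] using h
  funext x
  exact sub_eq_zero.1 (eq_zero_of_tendsto_zero hc hi (hv.1.sub hc hs.1) h0 x)

theorem jostSolution_atTop (k : ℝ) : jostSolution u atTop k = faddeevSolution u k :=
  (existsUnique_isJostSolution_atTop hc hi k).unique
    (Classical.epsilon_spec (p := IsJostSolution u atTop k)
      (existsUnique_isJostSolution_atTop hc hi k).exists)
    (isJostSolution_faddeevSolution hc hi k)

end

/-! ### Reflection, Jost solutions at `-∞` and scattering coefficients -/

theorem IsJostSolution.comp_neg {u : ℝ → ℝ} (hc : Continuous u) {l : Filter ℝ} {k : ℝ}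
    {v : ℝ → ℂ} (hv : IsJostSolution u l k v) :
    IsJostSolution (fun x => u (-x)) (l.map Neg.neg) (-k) (fun x => v (-x)) := by
  refine ⟨hv.1.comp_neg hc (neg_sq k), ?_⟩
  unfold IsEquivalent
  rw [isLittleO_map]
  refine hv.2.congr' (Eventually.of_forall fun x => ?_) (Eventually.of_forall fun x => ?_)
  · simp
  · simp

section

variable {u : ℝ → ℝ} (hc : Continuous u) (hi : Integrable fun x : ℝ => (1 + |x|) * |u x|)

include hi in
theorem integrable_weight_comp_neg :
    Integrable fun x : ℝ => (1 + |x|) * |u (-x)| := by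
  simpa using hi.comp_neg

include hc hi

theorem existsUnique_isJostSolution_atBot (k : ℝ) :
    ∃! v : ℝ → ℂ, IsJostSolution u atBot k v := by
  have hc' : Continuous fun x => u (-x) := by fun_prop
  have htop : (atTop : Filter ℝ).map Neg.neg = atBot := map_neg_atTop
  have hbot : (atBot : Filter ℝ).map Neg.neg = atTop := map_neg_atBot
  obtain ⟨w, hw, hu⟩ :=
    existsUnique_isJostSolution_atTop hc' (integrable_weight_comp_neg hi) (-k)
  refine ⟨fun x => w (-x), by simpa [htop] using hw.comp_neg hc', fun v hv => ?_⟩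
  have h := hv.comp_neg hc
  rw [hbot] at h
  funext x
  simpa using congrFun (hu _ h) (-x)

theorem jostSolution_atBot (k : ℝ) :
    jostSolution u atBot k = fun x => faddeevSolution (fun x => u (-x)) (-k) (-x) := by
  have hc' : Continuous fun x => u (-x) := by fun_prop
  have htop : (atTop : Filter ℝ).map Neg.neg = atBot := map_neg_atTop
  have h := (isJostSolution_faddeevSolution hc' (integrable_weight_comp_neg hi) (-k)).comp_neg
    hc'
  refine (existsUnique_isJostSolution_atBot hc hi k).unique
    (Classical.epsilon_spec (p := IsJostSolution u atBot k)
      (existsUnique_isJostSolution_atBot hc hi k).exists) ?_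
  simpa [htop] using h

/-- The exponentials cancel in the Wronskian, and its limit at `+∞` follows from `m → 1`, `m' → 0`.
For `k ≠ 0` it is nonzero, so `ψ_k` and `ψ̄_k` are independent. -/
theorem wronskian_faddeevSolution_neg (k x : ℝ) :
    wronskian (faddeevSolution u k) (faddeevSolution u (-k)) x = -(2 * Complex.I * k) := by
  have h1 := isSchrodingerSolution_faddeevSolution hc hi k
  -- The equation depends on `k` only through `k²`.
  have h2 : IsSchrodingerSolution u k (faddeevSolution u (-k)) := by
    simpa [IsSchrodingerSolution] using isSchrodingerSolution_faddeevSolution hc hi (-k)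
  refine h1.wronskian_eq_of_tendsto h2 ?_ x
  have hm := tendsto_faddeevM_atTop hc hi
  have hn := tendsto_faddeevDeriv_atTop hc hi
  have h := ((hm k).mul ((hn (-k : ℝ)).add ((hm (-k : ℝ)).const_mul
    (Complex.I * (-k : ℝ))))).sub
    (((hn k).add ((hm k).const_mul (Complex.I * k))).mul (hm (-k : ℝ)))
  have hlim : (1 : ℂ) * (0 + Complex.I * (-k : ℝ) * 1) - (0 + Complex.I * k * 1) * 1 =
      -(2 * Complex.I * k) := by
    push_cast
    ring
  rw [hlim] at h
  refine h.congr fun y => ?_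
  rw [wronskian, deriv_faddeevSolution hc hi, deriv_faddeevSolution hc hi, faddeevSolution,
    faddeevSolution]
  have he : Complex.exp (Complex.I * k * y) * Complex.exp (Complex.I * (-k : ℝ) * y) = 1 := by
    rw [← Complex.exp_add]
    simp
  linear_combination (-(faddeevM u k y * (faddeevDeriv u (-k : ℝ) y + Complex.I * (-k : ℝ) *
    faddeevM u (-k : ℝ) y) - (faddeevDeriv u k y + Complex.I * k * faddeevM u k y) *
    faddeevM u (-k : ℝ) y)) * he

theorem isSchrodingerSolution_jostPhi (k : ℝ) : IsSchrodingerSolution u k (jostPhi u k) := by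
  have h : IsJostSolution u atBot (-k) (jostPhi u k) :=
    Classical.epsilon_spec (existsUnique_isJostSolution_atBot hc hi (-k)).exists
  simpa [IsSchrodingerSolution] using h.1

/-- Cramer's rule: pairing `φ_k` with `ψ̄_k` and with `ψ_k` in the Wronskian isolates `A` and `B`.
-/
theorem isScatteringPair_iff {k : ℝ} (hk : k ≠ 0) (p : ℂ × ℂ) :
    IsScatteringPair u k p ↔
      p = (-(wronskian (jostPhi u k) (faddeevSolution u (-k)) 0) / (2 * Complex.I * k),
        wronskian (jostPhi u k) (faddeevSolution u k) 0 / (2 * Complex.I * k)) := by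
  have hk0 : 2 * Complex.I * (k : ℂ) ≠ 0 := by simp [hk]
  have hφ := isSchrodingerSolution_jostPhi hc hi k
  have h1 := isSchrodingerSolution_faddeevSolution hc hi k
  have h2 : IsSchrodingerSolution u k (faddeevSolution u (-k)) := by
    simpa [IsSchrodingerSolution] using isSchrodingerSolution_faddeevSolution hc hi (-k)
  have hW := wronskian_faddeevSolution_neg hc hi k
  rw [IsScatteringPair, jostPsi, jostPsiBar, jostSolution_atTop hc hi, jostSolution_atTop hc hi]
  constructor
  · intro h
    have hd : deriv (jostPhi u k) 0 = p.1 * deriv (faddeevSolution u k) 0 +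
        p.2 * deriv (faddeevSolution u (-k)) 0 := by
      rw [funext h]
      exact (((h1.hasDerivAt 0).const_mul p.1).add ((h2.hasDerivAt 0).const_mul p.2)).deriv
    have hW0 := hW 0
    rw [wronskian] at hW0
    ext
    · rw [eq_div_iff hk0, wronskian, hd, h 0]
      linear_combination p.1 * hW0
    · rw [eq_div_iff hk0, wronskian, hd, h 0]
      linear_combination p.2 * hW0
  · rintro rfl x
    -- Constancy of the Wronskians moves the coefficients from `0` to `x`, where the claim is an
    -- algebraic identity.
    have e1 := hφ.wronskian_eq h1 0 x
    have e2 := hφ.wronskian_eq h2 0 x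
    have hWx := hW x
    simp only [e1, e2]
    rw [wronskian] at hWx ⊢
    rw [wronskian]
    rw [div_mul_eq_mul_div, div_mul_eq_mul_div, ← add_div, eq_div_iff hk0]
    linear_combination jostPhi u k x * hWx

theorem scatteringB_eq {k : ℝ} (hk : k ≠ 0) :
    scatteringB u k = wronskian (jostPhi u k) (faddeevSolution u k) 0 / (2 * Complex.I * k) := by
  have h : IsScatteringPair u k (Classical.epsilon (IsScatteringPair u k)) :=
    Classical.epsilon_spec (p := IsScatteringPair u k)
      ⟨_, (isScatteringPair_iff hc hi hk _).2 rfl⟩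
  rw [scatteringB, (isScatteringPair_iff hc hi hk _).1 h]

end

/-! ### Extension of `B`, limits in `k`, and the theorem -/

/-- The analytic extension of `B` to the upper half-plane. -/
def scatteringExt (u : ℝ → ℝ) (k : ℂ) : ℂ :=
  faddeevM (fun x => u (-x)) k 0 * faddeevM u k 0 +
    (faddeevM (fun x => u (-x)) k 0 * faddeevDeriv u k 0 +
      faddeevDeriv (fun x => u (-x)) k 0 * faddeevM u k 0) / (2 * Complex.I * k)

/-- At `x = 0` all exponentials equal one. The terms `i k m` in the two derivatives add up to `2 i k
m̃ m`, which yields the leading product after division. -/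
theorem scatteringExt_ofReal {u : ℝ → ℝ} (hc : Continuous u)
    (hi : Integrable fun x : ℝ => (1 + |x|) * |u x|) {k : ℝ} (hk : k ≠ 0) :
    scatteringExt u k = scatteringB u k := by
  have hk0 : 2 * Complex.I * (k : ℂ) ≠ 0 := by simp [hk]
  have hc' : Continuous fun x => u (-x) := by fun_prop
  have hd : deriv (fun x => faddeevSolution (fun x => u (-x)) k (-x)) 0 =
      -deriv (faddeevSolution (fun x => u (-x)) k) 0 := by
    simpa using deriv_comp_neg (faddeevSolution (fun x => u (-x)) k) (0 : ℝ)
  rw [scatteringB_eq hc hi hk, eq_div_iff hk0, scatteringExt, add_mul, div_mul_cancel₀ _ hk0,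
    wronskian, jostPhi, jostSolution_atBot hc hi, neg_neg, hd, deriv_faddeevSolution hc hi,
    deriv_faddeevSolution hc' (integrable_weight_comp_neg hi)]
  simp [faddeevSolution]
  ring

theorem tendstoAtInfinityIn_of_norm_sub_le {D : Set ℂ} {F : ℂ → ℂ} {c : ℂ} {C : ℝ}
    (h : ∀ k ∈ D, k ≠ 0 → ‖F k - c‖ ≤ C / ‖k‖) : TendstoAtInfinityIn D F c := by
  rw [TendstoAtInfinityIn, tendsto_iff_norm_sub_tendsto_zero]
  have h1 : Tendsto (fun k : ℂ => C / ‖k‖) (Bornology.cobounded ℂ ⊓ 𝓟 D) (𝓝 0) :=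
    (tendsto_const_nhds.div_atTop tendsto_norm_cobounded_atTop).mono_left inf_le_left
  refine squeeze_zero' (Eventually.of_forall fun _ => norm_nonneg _) ?_ h1
  have h2 : ∀ᶠ k : ℂ in Bornology.cobounded ℂ, k ≠ 0 :=
    (tendsto_norm_cobounded_atTop.eventually_gt_atTop 0).mono fun _ => norm_pos_iff.1
  rw [eventually_inf_principal]
  filter_upwards [h2] with k hk hD
  exact h k hD hk

theorem tendstoAtInfinityIn_faddeevM {u : ℝ → ℝ} (hc : Continuous u)
    (hi : Integrable fun x : ℝ => (1 + |x|) * |u x|) (x : ℝ) :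
    TendstoAtInfinityIn {k : ℂ | 0 ≤ k.im} (fun k => faddeevM u k x) 1 :=
  tendstoAtInfinityIn_of_norm_sub_le fun _ hk h0 => norm_faddeevM_sub_one_le_div hc hi hk h0 x

theorem TendstoAtInfinityIn.mono {D E : Set ℂ} {F : ℂ → ℂ} {c : ℂ}
    (h : TendstoAtInfinityIn D F c) (hED : E ⊆ D) : TendstoAtInfinityIn E F c :=
  Tendsto.mono_left h (inf_le_inf_left _ (principal_mono.2 hED))

/-- The product of the two Faddeev functions tends to one; the numerator of the fraction is bounded
uniformly in `k`. -/
theorem tendstoAtInfinityIn_scatteringExt {u : ℝ → ℝ} (hc : Continuous u)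
    (hi : Integrable fun x : ℝ => (1 + |x|) * |u x|) :
    TendstoAtInfinityIn {k : ℂ | 0 ≤ k.im} (scatteringExt u) 1 := by
  have hc' : Continuous fun x => u (-x) := by fun_prop
  have hi' := integrable_weight_comp_neg hi
  have h1 : TendstoAtInfinityIn {k : ℂ | 0 ≤ k.im} (fun k =>
      (faddeevM (fun x => u (-x)) k 0 * faddeevDeriv u k 0 +
        faddeevDeriv (fun x => u (-x)) k 0 * faddeevM u k 0) / (2 * Complex.I * k)) 0 := by
    have hM := fun k => norm_faddeevM_le hc hi k (le_refl (0 : ℝ))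
    have hM' := fun k => norm_faddeevM_le hc' hi' k (le_refl (0 : ℝ))
    have hN := fun k => norm_faddeevDeriv_le hc hi k (le_refl (0 : ℝ))
    have hN' := fun k => norm_faddeevDeriv_le hc' hi' k (le_refl (0 : ℝ))
    refine tendstoAtInfinityIn_of_norm_sub_le
      (C := (2 * growthBound (fun x => u (-x)) 0 0 * (weightTail u 0 * (2 * growthBound u 0 0)) +
        weightTail (fun x => u (-x)) 0 * (2 * growthBound (fun x => u (-x)) 0 0) *
          (2 * growthBound u 0 0)) / 2) fun k _ h0 => ?_
    rw [sub_zero, norm_div, div_div]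
    have hk : ‖2 * Complex.I * k‖ = 2 * ‖k‖ := by simp
    rw [hk]
    gcongr
    refine (norm_add_le _ _).trans (add_le_add ?_ ?_)
    · rw [norm_mul]
      exact mul_le_mul (hM' k) (hN k) (norm_nonneg _) ((norm_nonneg _).trans (hM' k))
    · rw [norm_mul]
      exact mul_le_mul (hN' k) (hM k) (norm_nonneg _) ((norm_nonneg _).trans (hN' k))
  have h2 := ((tendstoAtInfinityIn_faddeevM hc' hi' 0).mul
    (tendstoAtInfinityIn_faddeevM hc hi 0)).add h1
  rw [mul_one, add_zero] at h2
  exact h2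

theorem mainTheorem12 (u : ℝ → ℝ) (hu : IsFaddeevPotential u) :
    -- the Jost solutions and the coefficients are well defined
    (∀ k : ℝ, ∃! v : ℝ → ℂ, IsJostSolution u atBot k v) ∧
    (∀ k : ℝ, ∃! v : ℝ → ℂ, IsJostSolution u atTop k v) ∧
    (∀ k : ℝ, k ≠ 0 → ∃! p : ℂ × ℂ, IsScatteringPair u k p) ∧
    -- the upper half-plane: `M_k x` for each `x`, and `B k`
    (∀ x : ℝ, ∃ M : ℂ → ℂ,
      IsAnalyticExtension {k : ℂ | 0 ≤ k.im} (fun k : ℝ => normalizedM u k x) M ∧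
      TendstoAtInfinityIn {k : ℂ | 0 ≤ k.im} M 1) ∧
    (∃ B : ℂ → ℂ,
      IsAnalyticExtension {k : ℂ | 0 ≤ k.im ∧ k ≠ 0} (scatteringB u) B ∧
      TendstoAtInfinityIn {k : ℂ | 0 ≤ k.im ∧ k ≠ 0} B 1) ∧
    -- the lower half-plane: `N̄_k x` for each `x`
    (∀ x : ℝ, ∃ N : ℂ → ℂ,
      IsAnalyticExtension {k : ℂ | k.im ≤ 0} (fun k : ℝ => normalizedNBar u k x) N ∧
      TendstoAtInfinityIn {k : ℂ | k.im ≤ 0} N 1) := by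
  obtain ⟨hu2, hi⟩ := hu
  have hc : Continuous u := hu2.continuous
  have hc' : Continuous fun x => u (-x) := by fun_prop
  have hi' := integrable_weight_comp_neg hi
  -- `φ_k` is the reflection of the Faddeev solution of `u(-x)`, whence the argument `-x` in the
  -- witness for `M`; `ψ̄_k` has parameter `-k`, which carries the lower half-plane to the upper
  -- one.
  refine ⟨existsUnique_isJostSolution_atBot hc hi, existsUnique_isJostSolution_atTop hc hi,
    fun k hk => ?_, fun x => ⟨fun k => faddeevM (fun x => u (-x)) k (-x), ⟨?_, ?_, ?_⟩, ?_⟩,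
    ⟨scatteringExt u, ⟨?_, ?_, ?_⟩, ?_⟩,
    fun x => ⟨fun k => faddeevM u (-k) x, ⟨?_, ?_, ?_⟩, ?_⟩⟩
  · exact ⟨_, (isScatteringPair_iff hc hi hk _).2 rfl,
      fun p hp => (isScatteringPair_iff hc hi hk p).1 hp⟩
  · intro k _
    simp only [normalizedM]
    rw [jostPhi, jostSolution_atBot hc hi, neg_neg]
    simp only [faddeevSolution]
    rw [mul_right_comm, ← Complex.exp_add]
    simp
  · exact (continuous_faddeevM_left hc' hi' (-x)).continuousOn
  · rw [Complex.interior_setOfPred_le_im]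
    exact (differentiableOn_faddeevM hc' hi' (-x)).analyticOnNhd isOpen_im_pos
  · exact tendstoAtInfinityIn_faddeevM hc' hi' (-x)
  · intro k hk
    exact scatteringExt_ofReal hc hi (by simpa using hk.2)
  · intro k hk
    have h0 : 2 * Complex.I * k ≠ 0 := by simp [hk.2]
    have e1 := continuous_faddeevM_left hc hi 0
    have e2 := continuous_faddeevM_left hc' hi' 0
    have e3 := continuous_faddeevDeriv hc hi 0
    have e4 := continuous_faddeevDeriv hc' hi' 0
    have e5 : Continuous fun k : ℂ => 2 * Complex.I * k := by fun_prop
    exact ((e2.mul e1).continuousAt.add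
      (((e2.mul e3).add (e4.mul e1)).continuousAt.div e5.continuousAt h0)).continuousWithinAt
  -- The excluded point `0` lies on the boundary, so analyticity on the open half-plane suffices.
  · have hsub : interior {k : ℂ | 0 ≤ k.im ∧ k ≠ 0} ⊆ {k : ℂ | 0 < k.im} := by
      rw [← Complex.interior_setOfPred_le_im]
      exact interior_mono fun k hk => hk.1
    refine AnalyticOnNhd.mono ?_ hsub
    refine DifferentiableOn.analyticOnNhd ?_ isOpen_im_pos
    have e1 := differentiableOn_faddeevM hc hi 0
    have e2 := differentiableOn_faddeevM hc' hi' 0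
    have e3 := differentiableOn_faddeevDeriv hc hi 0
    have e4 := differentiableOn_faddeevDeriv hc' hi' 0
    have e5 : DifferentiableOn ℂ (fun k : ℂ => 2 * Complex.I * k) {k : ℂ | 0 < k.im} := by
      fun_prop
    refine (e2.mul e1).add (((e2.mul e3).add (e4.mul e1)).div e5 fun k hk => ?_)
    have hk0 : k ≠ 0 := by
      rintro rfl
      simp at hk
    simp [hk0]
  · exact (tendstoAtInfinityIn_scatteringExt hc hi).mono fun k hk => hk.1
  · intro k _
    simp only [normalizedNBar]
    rw [jostPsiBar, jostSolution_atTop hc hi]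
    simp only [faddeevSolution]
    rw [mul_right_comm, ← Complex.exp_add]
    simp
  · exact ((continuous_faddeevM_left hc hi x).comp continuous_neg).continuousOn
  · rw [Complex.interior_setOfPred_im_le]
    have h : DifferentiableOn ℂ (fun k => faddeevM u (-k) x) {k : ℂ | k.im < 0} :=
      (differentiableOn_faddeevM hc hi x).comp (differentiableOn_neg _) fun k hk => by
        simpa using hk
    exact h.analyticOnNhd (isOpen_lt Complex.continuous_im continuous_const)
  · refine tendstoAtInfinityIn_of_norm_sub_le
      (C := (∫ y, |u y|) * (2 * growthBound u x x)) fun k hk h0 => ?_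
    rw [← norm_neg k]
    exact norm_faddeevM_sub_one_le_div hc hi (by simpa using hk) (neg_ne_zero.2 h0) x

end
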